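/- Define the Fibonacci polynomials by $F_0(q)=0$, $F_1(q)=1$ and $F_n(q)=qF_{n-1}(q)+F_{n-2}(q)$, where the recurrence extends $F_n$ to all $n\in\mathbb{Z}$ (so $F_{-m}(q)=(-1)^{m+1}F_m(q)$), and the Lucas polynomials by $L_0(q)=2$, $L_1(q)=q$ and $L_n(q)=qL_{n-1}(q)+L_{n-2}(q)$ for $n\ge 2$. Let $$I_\nu(z)=\sum_{m=0}^\infty\frac{(z/2)^{\nu+2m}}{\Gamma(m+1)\Gamma(\nu+m+1)},\qquad J_\nu(z)=\sum_{m=0}^\infty\frac{(-1)^m(z/2)^{\nu+2m}}{\Gamma(m+1)\Gamma(\nu+m+1)}$$ be the modified and the ordinary Bessel function of the first kind. Let $\alpha,\beta_0,\beta_1,d$ be positive integers and let $r$ be a nonnegative integer. Let $\xi(\alpha,\beta_0,\beta_1,d,r)=[a_0,a_1,a_2,\ldots]$ be the infinite simple continued fraction (the limit of its convergents) with $a_{r+nd}=\beta_0+\beta_1 n$ for all $n\ge 0$ and $a_i=\alpha$ for all other $i$, that is, $$\xi(\alpha,\beta_0,\beta_1,d,r)=[\underbrace{\alpha,\ldots,\alpha}_{r},\beta_0,\overline{\underbrace{\alpha,\ldots,\alpha,\beta_0+\beta_1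 n}_{d}}]_{n=1}^{\infty}.$$ Put $$\sigma=\frac{\beta_0-\alpha}{\beta_1}+\frac{L_d(\alpha)}{\beta_1F_d(\alpha)},\qquad \rho=\frac{(-1)^{d-1}}{\beta_1^2F_d(\alpha)^2}.$$ Then the convergents converge, the denominators below are nonzero, and $$\xi(\alpha,\beta_0,\beta_1,d,r)=\frac{F_{r+1}(\alpha)I_{\sigma-1}(2\sqrt{\rho})+(-1)^{r+1}F_{d-r-1}(\alpha)I_{\sigma}(2\sqrt{\rho})}{F_{r}(\alpha)I_{\sigma-1}(2\sqrt{\rho})+(-1)^{r}F_{d-r}(\alpha)I_{\sigma}(2\sqrt{\rho})}$$ if $d$ is odd, and $$\xi(\alpha,\beta_0,\beta_1,d,r)=\frac{F_{r+1}(\alpha)J_{\sigma-1}(2\sqrt{-\rho})+(-1)^{r+1}F_{d-r-1}(\alpha)J_{\sigma}(2\sqrt{-\rho})}{F_{r}(\alpha)J_{\sigma-1}(2\sqrt{-\rho})+(-1)^{r}F_{d-r}(\alpha)J_{\sigma}(2\sqrt{-\rho})}$$ if $d$ is even. -/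

import Mathlib

namespace Hurwitzian

open Polynomial

/-- Fibonacci polynomials of nonnegative index: `F₀ = 0`, `F₁ = 1`, `Fₙ₊₂ = q Fₙ₊₁ + Fₙ`. -/
noncomputable def fibPolyNat : ℕ → ℤ[X]
  | 0 => 0
  | 1 => 1
  | (n + 2) => X * fibPolyNat (n + 1) + fibPolyNat n

/-- Fibonacci polynomials of arbitrary integer index: the unique extension of `fibPolyNat` that
satisfies the recurrence everywhere, that is, `F₋ₘ = (-1)ᵐ⁺¹ Fₘ` (here `m = n + 1`). -/
noncomputable def fibPoly : ℤ → ℤ[X]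
  | Int.ofNat n => fibPolyNat n
  | Int.negSucc n => (-1) ^ n * fibPolyNat (n + 1)

/-- Lucas polynomials: `L₀ = 2`, `L₁ = q`, `Lₙ₊₂ = q Lₙ₊₁ + Lₙ`. -/
noncomputable def lucasPoly : ℕ → ℤ[X]
  | 0 => 2
  | 1 => X
  | (n + 2) => X * lucasPoly (n + 1) + lucasPoly n

theorem fibPoly_natCast (n : ℕ) : fibPoly (n : ℤ) = fibPolyNat n := rfl

/-- The defining recurrence holds for all integer indices. -/
theorem fibPoly_add_two (n : ℤ) : fibPoly (n + 2) = X * fibPoly (n + 1) + fibPoly n := by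
  match n with
  | Int.ofNat n => rfl
  | Int.negSucc 0 =>
    change fibPolyNat 1 = X * fibPolyNat 0 + (-1) ^ 0 * fibPolyNat 1
    simp [fibPolyNat]
  | Int.negSucc 1 =>
    change fibPolyNat 0 = X * ((-1) ^ 0 * fibPolyNat 1) + (-1) ^ 1 * fibPolyNat 2
    simp [fibPolyNat]
  | Int.negSucc (k + 2) =>
    have h1 : Int.negSucc (k + 2) + 2 = Int.negSucc k := by omega
    have h2 : Int.negSucc (k + 2) + 1 = Int.negSucc (k + 1) := by omega
    rw [h1, h2]
    change (-1) ^ k * fibPolyNat (k + 1) = X * ((-1) ^ (k + 1) * fibPolyNat (k + 2)) +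
      (-1) ^ (k + 2) * fibPolyNat (k + 3)
    rw [show fibPolyNat (k + 3) = X * fibPolyNat (k + 2) + fibPolyNat (k + 1) from rfl]
    ring

/-- The value `Fₙ(q)` at a real number `q`, for an integer index `n`. -/
noncomputable def F (n : ℤ) (q : ℝ) : ℝ := aeval q (fibPoly n)

/-- The value `Lₙ(q)` at a real number `q`. -/
noncomputable def L (n : ℕ) (q : ℝ) : ℝ := aeval q (lucasPoly n)

/-- The Bessel function of the first kind `J_ν(z)`, for real `ν` and `z > 0`.
At the poles of `Γ` the term `1 / Γ` is `0`, as usual. -/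
noncomputable def besselJ (ν z : ℝ) : ℝ :=
  ∑' m : ℕ, (-1) ^ m * (z / 2) ^ (ν + 2 * (m : ℝ)) /
    (Real.Gamma ((m : ℝ) + 1) * Real.Gamma (ν + (m : ℝ) + 1))

/-- The modified Bessel function of the first kind `I_ν(z)`, for real `ν` and `z > 0`. -/
noncomputable def besselI (ν z : ℝ) : ℝ :=
  ∑' m : ℕ, (z / 2) ^ (ν + 2 * (m : ℝ)) /
    (Real.Gamma ((m : ℝ) + 1) * Real.Gamma (ν + (m : ℝ) + 1))

/-- The entries `a₀, a₁, a₂, …` of the continued fraction `ξ(α, β₀, β₁, d, r)`: first `r` entries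
`α`, then `β₀`, then for `n = 1, 2, …` a block of `d - 1` entries `α` followed by `β₀ + β₁ n`. So
`a_{r + n d} = β₀ + β₁ n` for `n ≥ 0`, and all the other entries are `α`. -/
def entry (α β₀ β₁ d r : ℕ) (i : ℕ) : ℕ :=
  if r ≤ i ∧ d ∣ i - r then β₀ + β₁ * ((i - r) / d) else α

/-- The simple continued fraction `[a₀, a₁, a₂, …]` with all partial numerators equal to `1`. -/
def simpleCF (a : ℕ → ℝ) : GenContFract ℝ where
  h := a 0
  s := Stream'.Seq.ofStream (fun n : ℕ => (⟨1, a (n + 1)⟩ : GenContFract.Pair ℝ))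

/-- The infinite continued fraction `ξ(α, β₀, β₁, d, r)`. Its value is the limit of its
convergents. -/
def xi (α β₀ β₁ d r : ℕ) : GenContFract ℝ :=
  simpleCF (fun i => (entry α β₀ β₁ d r i : ℝ))

/-- The magic sum `σ`. -/
noncomputable def magicSum (α β₀ β₁ d : ℕ) : ℝ :=
  ((β₀ : ℝ) - (α : ℝ)) / (β₁ : ℝ) + L d (α : ℝ) / ((β₁ : ℝ) * F (d : ℤ) (α : ℝ))

/-- The magic quotient `ρ` (for `d ≥ 1`). -/
noncomputable def magicQuot (α β₁ d : ℕ) : ℝ :=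
  (-1) ^ (d - 1) / ((β₁ : ℝ) ^ 2 * F (d : ℤ) (α : ℝ) ^ 2)

end Hurwitzian

/-! A simple continued fraction `[a₀, a₁, …]` is governed by the recurrence
`vᵢ = aᵢ vᵢ₊₁ + vᵢ₊₂`: if `Aₙ / Bₙ` are its convergents, with the indexing of
`GenContFract.contsAux`, then `Bₙ v₀ - Aₙ v₁ = ± vₙ₊₁` for every solution `v`. As `Bₙ` grows at
least like the Fibonacci numbers when all `aᵢ ≥ 1`, a bounded nonzero solution has `v₁ ≠ 0`, and
the convergents tend to `v₀ / v₁` (`tendsto_convs_simpleCF`). No positivity of `v` is needed, so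
the cases of odd and even `d` are treated alike, and the denominators in the theorem are seen to be
nonzero without any knowledge of the zeros of Bessel functions.

It remains to find such a solution for `ξ`. Let `g(ν) = ∑ ρᵐ / (m! Γ(ν + m + 1))`
(`besselSeries`), which satisfies `g(ν - 1) = ν g(ν) + ρ g(ν + 1)`, and let `c = β₁ F_d(α)`, so that
`ρ = ± c⁻²`. Along a run of entries `α` the solution has to satisfy the Fibonacci recurrence, read
backwards, so that it is a combination of `F_j` and `(-1)ʲ F_{d-j}`, where `j` is the distance to
the end of the run. The choice (`blockValue`)
`v_{r + n d + 1 - j} = c⁻ⁿ (F_j g(σ + n - 1) + (-1)ʲ F_{d-j} c⁻¹ g(σ + n))`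
makes consecutive runs agree where they overlap, and since
`(σ + n) c = (β₀ + β₁ n) F_d + 2 F_{d-1}` the recurrence at the entry `β₀ + β₁ n` is exactly the
relation of `g` at `ν = σ + n` (`blockValue_one`). This `v` is bounded, because `g(σ + n)` is, and
nonzero, because `g(ν) > 0` for `ν ≥ 2` (`abs_besselSeries_sub_le`).

Finally `I_ν(2√ρ)` for odd `d`, and `J_ν(2√(-ρ))` for even `d`, equal `c^{-ν} g(ν)`, so the ratio
`v₀ / v₁` is the one claimed. -/

namespace Hurwitzian

open Filter Topology

/-! ### Fibonacci and Lucas values -/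

theorem F_add_two (n : ℤ) (q : ℝ) : F (n + 2) q = q * F (n + 1) q + F n q := by
  simp [F, fibPoly_add_two]

theorem F_zero (q : ℝ) : F 0 q = 0 := by
  simp [F, show fibPoly 0 = 0 from rfl]

theorem F_one (q : ℝ) : F 1 q = 1 := by
  simp [F, show fibPoly 1 = 1 from rfl]

theorem F_natCast_nonneg {q : ℝ} (hq : 0 ≤ q) (n : ℕ) : 0 ≤ F n q := by
  induction n using Nat.twoStepInduction with
  | zero => simp [F_zero]
  | one => simp [F_one]
  | more n h₀ h₁ =>
    have h := F_add_two n q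
    push_cast at h₁ ⊢
    rw [h]
    positivity

theorem one_le_F_natCast_succ {q : ℝ} (hq : 1 ≤ q) (n : ℕ) : 1 ≤ F ((n : ℤ) + 1) q := by
  induction n with
  | zero => simp [F_one]
  | succ n ih =>
    have h := F_add_two n q
    have h₀ := F_natCast_nonneg (by linarith : 0 ≤ q) n
    push_cast
    rw [show (n : ℤ) + 1 + 1 = n + 2 by ring, h]
    nlinarith

theorem L_succ (n : ℕ) (q : ℝ) :
    L (n + 1) q = q * F ((n : ℤ) + 1) q + 2 * F n q := by
  induction n using Nat.twoStepInduction with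
  | zero => simp [L, lucasPoly, F_zero, F_one]
  | one =>
    have h := F_add_two 0 q
    simp only [zero_add, F_zero, F_one] at h
    rw [show L (1 + 1) q = q * q + 2 by simp [L, lucasPoly, map_ofNat]]
    simp [F_one, h]
  | more n h₀ h₁ =>
    have hL : L (n + 2 + 1) q = q * L (n + 1 + 1) q + L (n + 1) q := by simp [L, lucasPoly]
    have h₂ := F_add_two n q
    have h₃ := F_add_two (n + 1) q
    push_cast at h₁ ⊢
    rw [show (n : ℤ) + 1 + 2 = n + 2 + 1 by ring, show (n : ℤ) + 1 + 1 = n + 2 by ring] at h₃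
    rw [show (n : ℤ) + 1 + 1 = n + 2 by ring] at h₁
    rw [hL, h₀, h₁, h₃, h₂]
    ring

/-! ### Convergence of a continued fraction from a bounded solution of its recurrence -/

section ContinuedFraction

variable (a : ℕ → ℝ)

theorem simpleCF_contsAux_add_two (n : ℕ) :
    (simpleCF a).contsAux (n + 2) =
      ⟨a (n + 1) * ((simpleCF a).contsAux (n + 1)).a + ((simpleCF a).contsAux n).a,
        a (n + 1) * ((simpleCF a).contsAux (n + 1)).b + ((simpleCF a).contsAux n).b⟩ := by
  have h : (simpleCF a).s.get? n = some ⟨1, a (n + 1)⟩ := rfl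
  rw [GenContFract.contsAux_recurrence h rfl rfl]
  simp

variable {a}

theorem fib_le_simpleCF_contsAux (ha : ∀ n, 1 ≤ a n) (n : ℕ) :
    (Nat.fib n : ℝ) ≤ ((simpleCF a).contsAux n).b := by
  induction n using Nat.twoStepInduction with
  | zero => simp [GenContFract.contsAux]
  | one => simp [GenContFract.contsAux]
  | more n h₀ h₁ =>
    rw [simpleCF_contsAux_add_two, Nat.fib_add_two]
    push_cast
    have : (0 : ℝ) ≤ Nat.fib (n + 1) := by positivity
    nlinarith [ha (n + 1)]

theorem simpleCF_contsAux_sub {v : ℕ → ℝ} (hv : ∀ n, v n = a n * v (n + 1) + v (n + 2))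
    (n : ℕ) :
    ((simpleCF a).contsAux n).b * v 0 - ((simpleCF a).contsAux n).a * v 1 =
      (-1) ^ (n + 1) * v (n + 1) := by
  induction n using Nat.twoStepInduction with
  | zero => simp [GenContFract.contsAux]
  | one =>
    have : (simpleCF a).h = a 0 := rfl
    simp [GenContFract.contsAux, this, hv 0]
  | more n h₀ h₁ =>
    rw [simpleCF_contsAux_add_two]
    have h := hv (n + 1)
    calc _ = a (n + 1) * (((simpleCF a).contsAux (n + 1)).b * v 0 -
            ((simpleCF a).contsAux (n + 1)).a * v 1) +
          (((simpleCF a).contsAux n).b * v 0 - ((simpleCF a).contsAux n).a * v 1) := by ring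
      _ = _ := by rw [h₀, h₁, h]; ring

/-- A form of Pincherle's theorem: a bounded nonzero solution of the recurrence attached to a
simple continued fraction with entries at least `1` is minimal, so the convergents tend to the
ratio of its first two terms. The second term is nonzero, because the convergents' denominators
grow without bound. -/
theorem tendsto_convs_simpleCF (ha : ∀ n, 1 ≤ a n) {v : ℕ → ℝ}
    (hv : ∀ n, v n = a n * v (n + 1) + v (n + 2)) {C : ℝ} (hC : ∀ n, |v n| ≤ C)
    (hne : ∃ n, v n ≠ 0) :
    v 1 ≠ 0 ∧ Tendsto (fun n => (simpleCF a).convs n) atTop (𝓝 (v 0 / v 1)) := by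
  have hB : Tendsto (fun n => ((simpleCF a).contsAux n).b) atTop atTop := by
    refine tendsto_atTop_mono (fun n => ?_)
      (tendsto_atTop_add_const_right _ (-1 : ℝ) tendsto_natCast_atTop_atTop)
    have h₁ := fib_le_simpleCF_contsAux ha n
    have h₂ : (n : ℝ) ≤ Nat.fib n + 1 := by exact_mod_cast Nat.le_fib_add_one n
    linarith
  have hE : Tendsto (fun n => (-1 : ℝ) ^ (n + 1) * v (n + 1) / ((simpleCF a).contsAux n).b)
      atTop (𝓝 0) := by
    rw [tendsto_zero_iff_abs_tendsto_zero]
    refine squeeze_zero' (Eventually.of_forall fun n => abs_nonneg _) ?_ (hB.const_div_atTop C)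
    filter_upwards [hB.eventually_gt_atTop 0] with n hn
    rw [Function.comp_apply, abs_div, abs_mul, abs_pow, abs_neg, abs_one, one_pow, one_mul,
      abs_of_pos hn]
    exact div_le_div_of_nonneg_right (hC _) hn.le
  have h₁ : v 1 ≠ 0 := by
    intro h₁
    have h₀ : v 0 = 0 := by
      refine tendsto_nhds_unique (tendsto_const_nhds (f := atTop)) (hE.congr' ?_)
      filter_upwards [hB.eventually_gt_atTop 0] with n hn
      rw [← simpleCF_contsAux_sub hv, h₁]
      field_simp
      ring
    obtain ⟨n, hn⟩ := hne
    have hz : ∀ n, v n = 0 := by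
      intro n
      induction n using Nat.twoStepInduction with
      | zero => exact h₀
      | one => exact h₁
      | more n i₀ i₁ => simpa [i₀, i₁] using (hv n).symm
    exact hn (hz n)
  refine ⟨h₁, ?_⟩
  have h := (tendsto_const_nhds (x := v 0 / v 1)).sub (hE.div_const (v 1))
  rw [zero_div, sub_zero] at h
  rw [← tendsto_add_atTop_iff_nat 1] at h
  refine h.congr fun n => ?_
  have hn : ((simpleCF a).contsAux (n + 1)).b ≠ 0 := by
    have h₂ := fib_le_simpleCF_contsAux ha (n + 1)
    have h₃ : (0 : ℝ) < Nat.fib (n + 1) := by exact_mod_cast Nat.fib_pos.2 n.succ_pos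
    exact (h₃.trans_le h₂).ne'
  rw [← simpleCF_contsAux_sub hv]
  change _ = ((simpleCF a).contsAux (n + 1)).a / ((simpleCF a).contsAux (n + 1)).b
  field_simp
  ring

end ContinuedFraction

/-! ### The power series common to the two Bessel functions -/

/-- The `m`-th term of `besselSeries ρ ν`. -/
noncomputable def besselTerm (ρ ν : ℝ) (m : ℕ) : ℝ :=
  ρ ^ m / (Real.Gamma ((m : ℝ) + 1) * Real.Gamma (ν + m + 1))

/-- The series `∑ ρᵐ / (m! Γ(ν + m + 1))`. Up to the factor `(z / 2) ^ ν` it is `I_ν(z)` for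
`ρ = (z / 2)²`, and `J_ν(z)` for `ρ = -(z / 2)²`. -/
noncomputable def besselSeries (ρ ν : ℝ) : ℝ := ∑' m, besselTerm ρ ν m

theorem besselTerm_succ (ρ : ℝ) {ν : ℝ} (hν : -1 < ν) (m : ℕ) :
    besselTerm ρ ν (m + 1) = ρ / ((m + 1) * (ν + m + 1)) * besselTerm ρ ν m := by
  have hm : (0 : ℝ) ≤ m := m.cast_nonneg
  have h₁ : (m : ℝ) + 1 ≠ 0 := by positivity
  have h₂ : ν + m + 1 ≠ 0 := by linarith
  have h₃ := (Real.Gamma_pos_of_pos (by linarith : 0 < (m : ℝ) + 1)).ne'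
  have h₄ := (Real.Gamma_pos_of_pos (by linarith : 0 < ν + m + 1)).ne'
  unfold besselTerm
  push_cast
  rw [show ν + ((m : ℝ) + 1) + 1 = ν + m + 1 + 1 by ring, Real.Gamma_add_one h₁,
    Real.Gamma_add_one h₂]
  field_simp
  ring

theorem summable_besselTerm (ρ : ℝ) {ν : ℝ} (hν : -1 < ν) : Summable (besselTerm ρ ν) := by
  have hlim : Tendsto (fun m : ℕ => |ρ| / (ν + m + 1)) atTop (𝓝 0) := by
    refine Tendsto.const_div_atTop ?_ _
    exact tendsto_atTop_add_const_right _ _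
      (tendsto_atTop_add_const_left _ _ tendsto_natCast_atTop_atTop)
  refine summable_of_ratio_norm_eventually_le (r := 1 / 2) (by norm_num) ?_
  filter_upwards [hlim.eventually_le_const (by norm_num : (0 : ℝ) < 1 / 2)] with m hm
  have h₀ : (0 : ℝ) ≤ m := m.cast_nonneg
  have h₂ : 0 < ν + m + 1 := by linarith
  rw [besselTerm_succ ρ hν, norm_mul]
  refine mul_le_mul_of_nonneg_right (le_trans ?_ hm) (norm_nonneg _)
  rw [Real.norm_eq_abs, abs_div, abs_of_pos (by positivity : 0 < ((m : ℝ) + 1) * (ν + m + 1))]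
  refine div_le_div_of_nonneg_left (abs_nonneg _) h₂ ?_
  nlinarith

/-- The contiguous relation, equivalent to `I_{ν-1}(z) - I_{ν+1}(z) = (2ν / z) I_ν(z)` and to its
analogue for `J`. -/
theorem besselSeries_sub_one (ρ : ℝ) {ν : ℝ} (hν : 0 < ν) :
    besselSeries ρ (ν - 1) = ν * besselSeries ρ ν + ρ * besselSeries ρ (ν + 1) := by
  have s₀ := summable_besselTerm ρ (by linarith : -1 < ν - 1)
  have s₁ := summable_besselTerm ρ (by linarith : -1 < ν)
  have s₂ := summable_besselTerm ρ (by linarith : -1 < ν + 1)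
  have hterm : ∀ m, besselTerm ρ (ν - 1) m = ν * besselTerm ρ ν m + m * besselTerm ρ ν m := by
    intro m
    have hm : (0 : ℝ) ≤ m := m.cast_nonneg
    have h₂ : ν + m ≠ 0 := by linarith
    have h₃ := (Real.Gamma_pos_of_pos (by linarith : 0 < (m : ℝ) + 1)).ne'
    have h₄ := (Real.Gamma_pos_of_pos (by linarith : 0 < ν + m)).ne'
    unfold besselTerm
    rw [show ν - 1 + m + 1 = ν + m by ring, Real.Gamma_add_one h₂]
    field_simp
  have hshift : ∀ m : ℕ,
      ((m + 1 : ℕ) : ℝ) * besselTerm ρ ν (m + 1) = ρ * besselTerm ρ (ν + 1) m := by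
    intro m
    have hm : (m : ℝ) + 1 ≠ 0 := by positivity
    unfold besselTerm
    push_cast
    rw [Real.Gamma_add_one hm, show ν + ((m : ℝ) + 1) + 1 = ν + 1 + m + 1 by ring]
    field_simp
    ring
  have s₃ : Summable fun m : ℕ => (m : ℝ) * besselTerm ρ ν m := by
    rw [← summable_nat_add_iff 1]
    simpa only [hshift] using s₂.mul_left ρ
  unfold besselSeries
  rw [tsum_congr hterm, (s₁.mul_left ν).tsum_add s₃, tsum_mul_left, s₃.tsum_eq_zero_add]
  simp only [hshift, tsum_mul_left]
  simp

theorem abs_besselTerm_le {ρ ν : ℝ} (hρ : |ρ| ≤ 1) (hν : 2 ≤ ν) (m : ℕ) :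
    |besselTerm ρ ν m| ≤ (Real.Gamma (ν + 1))⁻¹ * (1 / 3) ^ m := by
  have hG := Real.Gamma_pos_of_pos (by linarith : 0 < ν + 1)
  induction m with
  | zero => simp [besselTerm, abs_of_pos hG]
  | succ m ih =>
    have hm : (0 : ℝ) ≤ m := m.cast_nonneg
    have h₁ : 0 < ((m : ℝ) + 1) * (ν + m + 1) := mul_pos (by linarith) (by linarith)
    rw [besselTerm_succ ρ (by linarith), abs_mul, abs_div, abs_of_pos h₁, pow_succ', ← mul_assoc,
      mul_comm _ (1 / 3 : ℝ), mul_assoc]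
    refine mul_le_mul ?_ ih (abs_nonneg _) (by norm_num)
    refine div_le_div₀ zero_le_one hρ (by norm_num) ?_
    nlinarith

/-- For `ν ≥ 2` and `|ρ| ≤ 1` the first term of the series dominates the sum of the others. -/
theorem abs_besselSeries_sub_le {ρ ν : ℝ} (hρ : |ρ| ≤ 1) (hν : 2 ≤ ν) :
    |besselSeries ρ ν - (Real.Gamma (ν + 1))⁻¹| ≤ (Real.Gamma (ν + 1))⁻¹ * (1 / 2) := by
  have h₀ : besselTerm ρ ν 0 = (Real.Gamma (ν + 1))⁻¹ := by simp [besselTerm]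
  rw [besselSeries, (summable_besselTerm ρ (by linarith)).tsum_eq_zero_add, h₀,
    add_sub_cancel_left, ← Real.norm_eq_abs]
  refine tsum_of_norm_bounded
    (g := fun m => (Real.Gamma (ν + 1))⁻¹ * (1 / 3) * (1 / 3 : ℝ) ^ m) ?_ fun m => ?_
  · have h := (hasSum_geometric_of_lt_one (by norm_num : (0 : ℝ) ≤ 1 / 3) (by norm_num)).mul_left
      ((Real.Gamma (ν + 1))⁻¹ * (1 / 3))
    rwa [mul_assoc, show (1 / 3 : ℝ) * (1 - 1 / 3)⁻¹ = 1 / 2 by norm_num] at h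
  · rw [Real.norm_eq_abs]
    refine (abs_besselTerm_le hρ hν (m + 1)).trans_eq ?_
    ring

theorem besselSeries_pos {ρ ν : ℝ} (hρ : |ρ| ≤ 1) (hν : 2 ≤ ν) : 0 < besselSeries ρ ν := by
  have hG := inv_pos.2 (Real.Gamma_pos_of_pos (by linarith : 0 < ν + 1))
  linarith [(abs_le.1 (abs_besselSeries_sub_le hρ hν)).1]

theorem besselSeries_le {ρ ν : ℝ} (hρ : |ρ| ≤ 1) (hν : 2 ≤ ν) : besselSeries ρ ν ≤ 3 / 2 := by
  have hG : 1 ≤ Real.Gamma (ν + 1) := by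
    have h := Real.Gamma_strictMonoOn_Ici.monotoneOn (Set.mem_Ici.2 le_rfl)
      (Set.mem_Ici.2 (by linarith : (2 : ℝ) ≤ ν + 1)) (by linarith)
    simpa using h
  have hG' := inv_le_one_of_one_le₀ hG
  linarith [(abs_le.1 (abs_besselSeries_sub_le hρ hν)).2]

theorem exists_abs_besselSeries_le {ρ : ℝ} (hρ : |ρ| ≤ 1) (ν : ℝ) :
    ∃ K, ∀ n : ℕ, |besselSeries ρ (ν + n)| ≤ K := by
  have hb : IsBoundedUnder (· ≤ ·) atTop fun n : ℕ => |besselSeries ρ (ν + n)| := by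
    refine isBoundedUnder_of_eventually_le (a := 3 / 2) ?_
    have h : Tendsto (fun n : ℕ => ν + (n : ℝ)) atTop atTop :=
      tendsto_atTop_add_const_left _ _ tendsto_natCast_atTop_atTop
    filter_upwards [h.eventually_ge_atTop 2] with n hn
    rw [abs_of_pos (besselSeries_pos hρ hn)]
    exact besselSeries_le hρ hn
  obtain ⟨K, hK⟩ := hb.bddAbove_range
  exact ⟨K, fun n => hK ⟨n, rfl⟩⟩

theorem besselI_eq {x : ℝ} (hx : 0 < x) (ν : ℝ) :
    besselI ν (2 * x) = x ^ ν * besselSeries (x ^ 2) ν := by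
  rw [besselI, besselSeries, ← tsum_mul_left]
  refine tsum_congr fun m => ?_
  rw [mul_div_cancel_left₀ x two_ne_zero, Real.rpow_add hx,
    show 2 * (m : ℝ) = ((2 * m : ℕ) : ℝ) by push_cast; ring, Real.rpow_natCast, pow_mul,
    besselTerm, mul_div_assoc]

theorem besselJ_eq {x : ℝ} (hx : 0 < x) (ν : ℝ) :
    besselJ ν (2 * x) = x ^ ν * besselSeries (-x ^ 2) ν := by
  rw [besselJ, besselSeries, ← tsum_mul_left]
  refine tsum_congr fun m => ?_
  rw [mul_div_cancel_left₀ x two_ne_zero, Real.rpow_add hx,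
    show 2 * (m : ℝ) = ((2 * m : ℕ) : ℝ) by push_cast; ring, Real.rpow_natCast, pow_mul,
    besselTerm, neg_pow (x ^ 2)]
  ring

/-! ### The solution of the recurrence along the blocks of entries -/

theorem entry_of_lt {α β₀ β₁ d r i : ℕ} (h : i < r) : entry α β₀ β₁ d r i = α :=
  if_neg fun h' => absurd h'.1 h.not_ge

theorem entry_special (α β₀ β₁ r n : ℕ) {d : ℕ} (hd : 0 < d) :
    entry α β₀ β₁ d r (r + n * d) = β₀ + β₁ * n := by
  simp [entry, hd]

theorem entry_of_between (α β₀ β₁ r n : ℕ) {d i : ℕ} (hi : i + 1 < d) :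
    entry α β₀ β₁ d r (r + n * d + 1 + i) = α := by
  refine if_neg fun h => ?_
  have h' := h.2
  rw [show r + n * d + 1 + i - r = (i + 1) + n * d by omega,
    Nat.dvd_add_left (Dvd.intro_left n rfl)] at h'
  exact absurd (Nat.le_of_dvd i.succ_pos h') (by omega)

/-- Along a run of `m` entries `α`, starting at the index `s`, a solution of the recurrence of the
continued fraction is a solution of the Fibonacci recurrence read backwards. -/
theorem eq_of_run {a v f : ℕ → ℝ} {α : ℝ} {s m : ℕ}
    (hv : ∀ n, v n = a n * v (n + 1) + v (n + 2)) (hf : ∀ j, f (j + 2) = α * f (j + 1) + f j)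
    (ha : ∀ i < m, a (s + i) = α) (h₁ : v s = f (m + 1)) (h₀ : v (s + 1) = f m) :
    ∀ i ≤ m, v (s + i) = f (m + 1 - i) ∧ v (s + i + 1) = f (m - i) := by
  intro i hi
  induction i with
  | zero => exact ⟨h₁, h₀⟩
  | succ i ih =>
    obtain ⟨e₁, e₀⟩ := ih (by omega)
    obtain ⟨k, rfl⟩ : ∃ k, m = i + 1 + k := ⟨m - (i + 1), by omega⟩
    rw [show i + 1 + k + 1 - i = k + 2 by omega] at e₁
    rw [show i + 1 + k - i = k + 1 by omega] at e₀
    rw [show i + 1 + k + 1 - (i + 1) = k + 1 by omega, show i + 1 + k - (i + 1) = k by omega]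
    refine ⟨e₀, ?_⟩
    have h := hv (s + i)
    rw [ha i (by omega), e₁, e₀, hf] at h
    have h' : v (s + i + 2) = f k := by linarith
    exact h'

/-- The solution of `vᵢ = aᵢ vᵢ₊₁ + vᵢ₊₂` with given `v₀` and `v₁`. -/
noncomputable def cfSolution (a : ℕ → ℝ) (v₀ v₁ : ℝ) : ℕ → ℝ
  | 0 => v₀
  | 1 => v₁
  | (n + 2) => cfSolution a v₀ v₁ n - a n * cfSolution a v₀ v₁ (n + 1)

/-- The values on the `n`-th block of the bounded solution of the recurrence attached to `ξ`:
`blockValue n j` is its value at the index `r + n d + 1 - j`. Here `g n` stands for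
`besselSeries ρ (σ - 1 + n)` and `c` for `β₁ F_d(α)`. -/
noncomputable def blockValue (q c : ℝ) (d : ℕ) (g : ℕ → ℝ) (n j : ℕ) : ℝ :=
  c⁻¹ ^ n * (F j q * g n + (-1) ^ j * F ((d : ℤ) - j) q * (g (n + 1) * c⁻¹))

section Block

variable (q c : ℝ) (d : ℕ) (g : ℕ → ℝ) (n : ℕ)

theorem blockValue_add_two (j : ℕ) :
    blockValue q c d g n (j + 2) = q * blockValue q c d g n (j + 1) + blockValue q c d g n j := by
  have h₁ := F_add_two j q
  have h₂ := F_add_two ((d : ℤ) - j - 2) q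
  rw [show (d : ℤ) - j - 2 + 2 = d - j by ring, show (d : ℤ) - j - 2 + 1 = d - j - 1 by ring]
    at h₂
  unfold blockValue
  push_cast
  rw [show (d : ℤ) - (j + 2) = d - j - 2 by ring, show (d : ℤ) - (j + 1) = d - j - 1 by ring, h₁,
    h₂]
  ring

/-- Consecutive blocks agree at the index which they share. -/
theorem blockValue_succ_self :
    blockValue q c d g (n + 1) d = blockValue q c d g n 0 := by
  simp [blockValue, F_zero]
  ring

theorem exists_abs_blockValue_le {K : ℝ} (hK : ∀ n, |g n| ≤ K) (hc : 1 ≤ c) (N : ℕ) :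
    ∃ C, ∀ n, ∀ j ≤ N, |blockValue q c d g n j| ≤ C := by
  have hK₀ : 0 ≤ K := (abs_nonneg _).trans (hK 0)
  have hc₀ : 0 ≤ c⁻¹ := inv_nonneg.2 (by linarith)
  have hc₁ : c⁻¹ ≤ 1 := inv_le_one_of_one_le₀ hc
  refine ⟨∑ j ∈ Finset.range (N + 1), (|F j q| + |F ((d : ℤ) - j) q|) * K, fun n j hj => ?_⟩
  refine le_trans ?_ (Finset.single_le_sum
    (f := fun j : ℕ => (|F j q| + |F ((d : ℤ) - j) q|) * K) (fun i _ => by positivity)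
    (Finset.mem_range.2 (Nat.lt_succ_of_le hj)))
  have h₁ : |F j q * g n| ≤ |F j q| * K := by
    rw [abs_mul]
    exact mul_le_mul_of_nonneg_left (hK n) (abs_nonneg _)
  have h₂ : |(-1) ^ j * F ((d : ℤ) - j) q * (g (n + 1) * c⁻¹)| ≤ |F ((d : ℤ) - j) q| * K := by
    rw [abs_mul, abs_mul, abs_pow, abs_neg, abs_one, one_pow, one_mul, abs_mul, abs_of_nonneg hc₀]
    refine mul_le_mul_of_nonneg_left ?_ (abs_nonneg _)
    exact (mul_le_of_le_one_right (abs_nonneg _) hc₁).trans (hK _)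
  rw [blockValue, abs_mul, abs_pow, abs_of_nonneg hc₀]
  refine (mul_le_of_le_one_left (abs_nonneg _) (pow_le_one₀ hc₀ hc₁)).trans ?_
  refine (abs_add_le _ _).trans ?_
  linarith

/-- The recurrence at the entry `b` that separates two blocks reduces to the contiguous relation
of the Bessel series. -/
theorem blockValue_one {ρ σ b : ℝ} (hd : 0 < d) (hc : c ≠ 0)
    (hρ : ρ = (-1) ^ (d - 1) * c⁻¹ ^ 2)
    (hσ : (σ + n) * c = b * F d q + 2 * F ((d : ℤ) - 1) q)
    (hg : g n = (σ + n) * g (n + 1) + ρ * g (n + 2)) :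
    blockValue q c d g n 1 = b * blockValue q c d g n 0 + blockValue q c d g (n + 1) (d - 1) := by
  obtain ⟨e, rfl⟩ : ∃ e, d = e + 1 := ⟨d - 1, by omega⟩
  have hs : σ + n = (b * F ((e + 1 : ℕ) : ℤ) q + 2 * F (((e + 1 : ℕ) : ℤ) - 1) q) * c⁻¹ := by
    rw [← hσ, mul_inv_cancel_right₀ hc]
  unfold blockValue
  rw [hg, hs, hρ]
  simp [F_zero, F_one]
  ring

end Block

/-- The value of the continued fraction in terms of the power series; the factor `c⁻¹` with
`c = β₁ F_d(α)` is the quotient of the prefactors of the two Bessel functions. -/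
theorem tendsto_convs_xi {α β₀ β₁ d : ℕ} (r : ℕ) (hα : 0 < α) (hβ₀ : 0 < β₀) (hβ₁ : 0 < β₁)
    (hd : 0 < d) {c σ ρ : ℝ} (hc : c = β₁ * F d α) (hσ : σ = magicSum α β₀ β₁ d)
    (hρ : ρ = (-1) ^ (d - 1) * c⁻¹ ^ 2) :
    F r α * besselSeries ρ (σ - 1) +
        (-1) ^ r * F ((d : ℤ) - r) α * (besselSeries ρ σ * c⁻¹) ≠ 0 ∧
      Tendsto (fun n : ℕ => (xi α β₀ β₁ d r).convs n) atTop
        (𝓝 ((F ((r : ℤ) + 1) α * besselSeries ρ (σ - 1) +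
            (-1) ^ (r + 1) * F ((d : ℤ) - r - 1) α * (besselSeries ρ σ * c⁻¹)) /
          (F r α * besselSeries ρ (σ - 1) +
            (-1) ^ r * F ((d : ℤ) - r) α * (besselSeries ρ σ * c⁻¹)))) := by
  have hα₁ : (1 : ℝ) ≤ α := by exact_mod_cast hα
  have hβ₁' : (1 : ℝ) ≤ β₁ := by exact_mod_cast hβ₁
  have hβ₀' : (1 : ℝ) ≤ β₀ := by exact_mod_cast hβ₀
  have hFd : 1 ≤ F d α := by
    have h := one_le_F_natCast_succ hα₁ (d - 1)
    rwa [show ((d - 1 : ℕ) : ℤ) + 1 = d by omega] at h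
  have hFd' : 0 ≤ F ((d : ℤ) - 1) α := by
    have h := F_natCast_nonneg (zero_le_one.trans hα₁) (d - 1)
    rwa [show ((d - 1 : ℕ) : ℤ) = d - 1 by omega] at h
  have hc₁ : 1 ≤ c := by rw [hc]; nlinarith
  have hc₀ : c ≠ 0 := by linarith
  have hσc : σ * c = β₀ * F d α + 2 * F ((d : ℤ) - 1) α := by
    have h := L_succ (d - 1) α
    rw [show d - 1 + 1 = d by omega, show ((d - 1 : ℕ) : ℤ) = d - 1 by omega,
      sub_add_cancel] at h
    have h₁ : (β₁ : ℝ) ≠ 0 := by linarith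
    have h₂ : F d α ≠ 0 := by linarith
    rw [hσ, hc, magicSum, h]
    field_simp
    ring
  have hσ₀ : 0 < σ := by
    refine pos_of_mul_pos_left (b := c) ?_ (by linarith)
    rw [hσc]
    positivity
  have hρ₁ : |ρ| ≤ 1 := by
    rw [hρ, abs_mul, abs_pow, abs_neg, abs_one, one_pow, one_mul, abs_pow,
      abs_of_nonneg (inv_nonneg.2 (by linarith : 0 ≤ c))]
    exact pow_le_one₀ (inv_nonneg.2 (by linarith)) (inv_le_one_of_one_le₀ hc₁)
  set g : ℕ → ℝ := fun n => besselSeries ρ (σ - 1 + n)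
  have hg₀ : g 0 = besselSeries ρ (σ - 1) := by simp [g]
  have hg₁ : g 1 = besselSeries ρ σ := by simp [g]
  have hg : ∀ n : ℕ, g n = (σ + n) * g (n + 1) + ρ * g (n + 2) := by
    intro n
    have h := besselSeries_sub_one ρ (by positivity : 0 < σ + n)
    simp only [g]
    push_cast
    rw [show σ - 1 + (n : ℝ) = σ + n - 1 by ring, h]
    congr 3 <;> ring
  set a : ℕ → ℝ := fun i => (entry α β₀ β₁ d r i : ℝ)
  have ha : ∀ n, 1 ≤ a n := by
    intro n
    have h : 1 ≤ entry α β₀ β₁ d r n := by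
      unfold entry
      split_ifs <;> omega
    exact Nat.one_le_cast.2 h
  set W := blockValue (α : ℝ) c d g with hW
  set v := cfSolution a (W 0 (r + 1)) (W 0 r)
  have hv : ∀ n, v n = a n * v (n + 1) + v (n + 2) := by
    intro n
    have h : v (n + 2) = v n - a n * v (n + 1) := rfl
    rw [h]
    ring
  have hf : ∀ n j, W n (j + 2) = α * W n (j + 1) + W n j := fun n j =>
    blockValue_add_two _ _ _ _ _ _
  have hrun₀ := eq_of_run (s := 0) (m := r) hv (hf 0)
    (fun i hi => by rw [zero_add]; exact congrArg Nat.cast (entry_of_lt hi)) rfl rfl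
  have hstep : ∀ n, v (r + n * d) = W n 1 → v (r + n * d + 1) = W n 0 →
      ∀ i ≤ d - 1, v (r + n * d + 1 + i) = W (n + 1) (d - 1 + 1 - i) ∧
        v (r + n * d + 1 + i + 1) = W (n + 1) (d - 1 - i) := by
    intro n e₁ e₀
    refine eq_of_run hv (hf (n + 1)) (fun i hi => ?_) ?_ ?_
    · exact congrArg Nat.cast (entry_of_between α β₀ β₁ r n (by omega))
    · rw [show d - 1 + 1 = d by omega, e₀]
      exact (blockValue_succ_self _ _ _ _ _).symm
    · have h := hv (r + n * d)
      have hb : a (r + n * d) = β₀ + β₁ * n := by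
        simp only [a, entry_special α β₀ β₁ r n hd]
        push_cast
        ring
      have hone : W n 1 = (β₀ + β₁ * n) * W n 0 + W (n + 1) (d - 1) := by
        refine blockValue_one _ _ _ _ _ hd hc₀ hρ ?_ (hg n)
        rw [add_mul, hσc, hc]
        ring
      rw [e₁, e₀, hb, hone] at h
      exact (add_left_cancel h).symm
  have hblock : ∀ n, v (r + n * d) = W n 1 ∧ v (r + n * d + 1) = W n 0 := by
    intro n
    induction n with
    | zero => simpa using hrun₀ r le_rfl
    | succ n ih =>
      have h := hstep n ih.1 ih.2 (d - 1) le_rfl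
      rw [show d - 1 + 1 - (d - 1) = 1 by omega, show d - 1 - (d - 1) = 0 by omega,
        show r + n * d + 1 + (d - 1) = r + (n + 1) * d by rw [add_mul]; omega] at h
      exact h
  obtain ⟨K, hK⟩ := exists_abs_besselSeries_le hρ₁ (σ - 1)
  obtain ⟨C, hC⟩ := exists_abs_blockValue_le (α : ℝ) c d g hK hc₁ (r + 1 + d)
  have hvC : ∀ k, |v k| ≤ C := by
    intro k
    rcases le_or_gt k r with hk | hk
    · have h := (hrun₀ k hk).1
      rw [zero_add] at h
      rw [h]
      exact hC _ _ (by omega)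
    · obtain ⟨k, rfl⟩ : ∃ l, k = r + 1 + l := ⟨k - (r + 1), by omega⟩
      have hmod := Nat.mod_lt k hd
      have hdiv := Nat.div_add_mod' k d
      have h := (hstep (k / d) (hblock _).1 (hblock _).2 (k % d) (by omega)).1
      rw [show r + k / d * d + 1 + k % d = r + 1 + k by omega] at h
      rw [h]
      exact hC _ _ (by omega)
  have hne : ∃ k, v k ≠ 0 := by
    obtain ⟨n, hn⟩ := exists_nat_ge (2 - σ)
    refine ⟨r + n * d + 1, ?_⟩
    have hpos : 0 < g (n + 1) := besselSeries_pos hρ₁ (by push_cast; linarith)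
    have hcpos : 0 < c⁻¹ := inv_pos.2 (by linarith)
    rw [(hblock n).2, hW, blockValue]
    simp only [Nat.cast_zero, F_zero, zero_mul, zero_add, pow_zero, one_mul, sub_zero]
    have : 0 < F d α := by linarith
    positivity
  have hmain := tendsto_convs_simpleCF ha hv hvC hne
  have e₀ : v 0 = F ((r : ℤ) + 1) α * besselSeries ρ (σ - 1) +
      (-1) ^ (r + 1) * F ((d : ℤ) - r - 1) α * (besselSeries ρ σ * c⁻¹) := by
    change blockValue _ _ _ _ _ _ = _
    rw [blockValue, hg₀, hg₁, pow_zero, one_mul]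
    push_cast
    rw [sub_sub]
  have e₁ : v 1 = F r α * besselSeries ρ (σ - 1) +
      (-1) ^ r * F ((d : ℤ) - r) α * (besselSeries ρ σ * c⁻¹) := by
    change blockValue _ _ _ _ _ _ = _
    rw [blockValue, hg₀, hg₁, pow_zero, one_mul]
  rw [e₀, e₁] at hmain
  exact hmain

/-- A common positive factor of the two Bessel values cancels from the formula of
`tendsto_convs_xi`. -/
theorem ne_zero_and_tendsto_of_common_factor {u : ℕ → ℝ} {x A B P Q R S A' B' : ℝ} (hx : x ≠ 0)
    (hA : A' = x * A) (hB : B' = x * B)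
    (h : R * A + S * B ≠ 0 ∧ Tendsto u atTop (𝓝 ((P * A + Q * B) / (R * A + S * B)))) :
    R * A' + S * B' ≠ 0 ∧ Tendsto u atTop (𝓝 ((P * A' + Q * B') / (R * A' + S * B'))) := by
  have h₁ : R * A' + S * B' = x * (R * A + S * B) := by rw [hA, hB]; ring
  have h₂ : P * A' + Q * B' = x * (P * A + Q * B) := by rw [hA, hB]; ring
  rw [h₁, h₂, mul_div_mul_left _ _ hx]
  exact ⟨mul_ne_zero hx h.1, h.2⟩

end Hurwitzian

theorem theorem2 (α β₀ β₁ d r : ℕ) (hα : 0 < α) (hβ₀ : 0 < β₀) (hβ₁ : 0 < β₁) (hd : 0 < d)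
    (σ ρ : ℝ) (hσ : σ = Hurwitzian.magicSum α β₀ β₁ d) (hρ : ρ = Hurwitzian.magicQuot α β₁ d) :
    (Odd d →
      Hurwitzian.F r α * Hurwitzian.besselI (σ - 1) (2 * Real.sqrt ρ) +
          (-1) ^ r * Hurwitzian.F ((d : ℤ) - r) α * Hurwitzian.besselI σ (2 * Real.sqrt ρ) ≠ 0 ∧
      Filter.Tendsto (fun n : ℕ => (Hurwitzian.xi α β₀ β₁ d r).convs n) Filter.atTop
        (nhds
          ((Hurwitzian.F ((r : ℤ) + 1) α * Hurwitzian.besselI (σ - 1) (2 * Real.sqrt ρ) +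
              (-1) ^ (r + 1) * Hurwitzian.F ((d : ℤ) - r - 1) α *
                Hurwitzian.besselI σ (2 * Real.sqrt ρ)) /
            (Hurwitzian.F r α * Hurwitzian.besselI (σ - 1) (2 * Real.sqrt ρ) +
              (-1) ^ r * Hurwitzian.F ((d : ℤ) - r) α *
                Hurwitzian.besselI σ (2 * Real.sqrt ρ))))) ∧
    (Even d →
      Hurwitzian.F r α * Hurwitzian.besselJ (σ - 1) (2 * Real.sqrt (-ρ)) +
          (-1) ^ r * Hurwitzian.F ((d : ℤ) - r) α * Hurwitzian.besselJ σ (2 * Real.sqrt (-ρ)) ≠ 0 ∧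
      Filter.Tendsto (fun n : ℕ => (Hurwitzian.xi α β₀ β₁ d r).convs n) Filter.atTop
        (nhds
          ((Hurwitzian.F ((r : ℤ) + 1) α * Hurwitzian.besselJ (σ - 1) (2 * Real.sqrt (-ρ)) +
              (-1) ^ (r + 1) * Hurwitzian.F ((d : ℤ) - r - 1) α *
                Hurwitzian.besselJ σ (2 * Real.sqrt (-ρ))) /
            (Hurwitzian.F r α * Hurwitzian.besselJ (σ - 1) (2 * Real.sqrt (-ρ)) +
              (-1) ^ r * Hurwitzian.F ((d : ℤ) - r) α *
                Hurwitzian.besselJ σ (2 * Real.sqrt (-ρ)))))) := by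
  have hα₁ : (1 : ℝ) ≤ α := by exact_mod_cast hα
  have hFd : 0 < Hurwitzian.F d α := by
    have h := Hurwitzian.one_le_F_natCast_succ hα₁ (d - 1)
    rw [show ((d - 1 : ℕ) : ℤ) + 1 = d by omega] at h
    linarith
  obtain ⟨c, hc⟩ : ∃ c : ℝ, c = β₁ * Hurwitzian.F d α := ⟨_, rfl⟩
  have hx : 0 < c⁻¹ := by rw [hc]; positivity
  have hρc : ρ = (-1) ^ (d - 1) * c⁻¹ ^ 2 := by
    rw [hρ, Hurwitzian.magicQuot, hc, mul_inv, mul_pow, inv_pow, inv_pow, ← mul_inv,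
      div_eq_mul_inv]
  have key := Hurwitzian.tendsto_convs_xi r hα hβ₀ hβ₁ hd hc hσ hρc
  have hpow : c⁻¹ ^ σ = c⁻¹ ^ (σ - 1) * c⁻¹ := by
    rw [← Real.rpow_add_one hx.ne', sub_add_cancel]
  refine ⟨fun hodd => ?_, fun heven => ?_⟩
  · have hρx : ρ = c⁻¹ ^ 2 := by
      rw [hρc, (Nat.Odd.sub_odd hodd odd_one).neg_one_pow, one_mul]
    have hsqrt : Real.sqrt ρ = c⁻¹ := by rw [hρx, Real.sqrt_sq hx.le]
    rw [hsqrt]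
    refine Hurwitzian.ne_zero_and_tendsto_of_common_factor (Real.rpow_pos_of_pos hx (σ - 1)).ne'
      ?_ ?_ key
    · rw [Hurwitzian.besselI_eq hx, ← hρx]
    · rw [Hurwitzian.besselI_eq hx, ← hρx, hpow]
      ring
  · have hρx : ρ = -c⁻¹ ^ 2 := by
      rw [hρc, (Nat.Even.sub_odd hd heven odd_one).neg_one_pow, neg_one_mul]
    have hsqrt : Real.sqrt (-ρ) = c⁻¹ := by rw [hρx, neg_neg, Real.sqrt_sq hx.le]
    rw [hsqrt]
    refine Hurwitzian.ne_zero_and_tendsto_of_common_factor (Real.rpow_pos_of_pos hx (σ - 1)).ne'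
      ?_ ?_ key
    · rw [Hurwitzian.besselJ_eq hx, ← hρx]
    · rw [Hurwitzian.besselJ_eq hx, ← hρx, hpow]
      ring
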